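/- Let $\overline{\mathbb Q}$ be a fixed algebraic closure of $\mathbb Q$, and let $Y$ be the set of places $y$ of $\overline{\mathbb Q}$. For $y\in Y$ let $\|\cdot\|_y$ be the absolute value in $y$ whose restriction to $\mathbb Q$ is the usual archimedean or the usual $p$-adic absolute value for some prime $p$. For a number field $k\subset\overline{\mathbb Q}$ and a place $v$ of $k$ let $Y(k,v)$ be the set of places in $Y$ lying over $v$. Give $Y$ the (totally disconnected, locally compact Hausdorff) topology generated by the sets $Y(k,v)$. The group $\mathrm{Aut}(\overline{\mathbb Q}/\mathbb Q)$ acts continuously on $Y$ by $\|x\|_{\tau y}=\|\tau^{-1}x\|_y$. Let $\lambda$ be the unique regular, $\mathrm{Aut}(\overline{\mathbb Q}/\mathbb Q)$-invariant measure on the Borel $\sigma$-algebra $\mathcal B$ of $Y$ such that $$\lambda\bigl(Y(k,v)\bigr)=\frac{[k_v:\mathbb Q_v]}{[k:\mathbb Q]}$$ for every finite Galois extension $k/\mathbb Q$ and every place $v$ of $k$, and let $$\mathcal X=\Bigl\{F\in L^1(Y,\mathcal B,\lambda):\int_Y F\,d\lambda=0\Bigr\},$$ a real Banach space with the $L^1$-norm.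 For a field $K$ with $\mathbb Q\subseteq K\subseteq\overline{\mathbb Q}$ let $\nu_K$ be the Haar measure of total mass $1$ on the compact group $\mathrm{Aut}(\overline{\mathbb Q}/K)$, and let $U_K:\mathcal X\to\mathcal X$ be the continuous linear operator given, for $F\in\mathcal X$ and $\lambda$-almost every $y\in Y$, by $$U_K(F)(y)=\int_{\mathrm{Aut}(\overline{\mathbb Q}/K)}F(\tau^{-1}y)\,d\nu_K(\tau).$$ **Theorem.** Let $K$ and $L$ be fields with $\mathbb Q\subseteq K,L\subseteq\overline{\mathbb Q}$. If $K/(K\cap L)$ is a (possibly infinite) Galois extension, or if $L/(K\cap L)$ is a (possibly infinite) Galois extension, then $$U_K\circ U_L=U_L\circ U_K .$$ -/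

import Mathlib

open MeasureTheory

noncomputable section

namespace WeilHeight

/-- A fixed algebraic closure of `ℚ`. -/
def Qbar : Type := AlgebraicClosure ℚ

instance : Field Qbar := inferInstanceAs (Field (AlgebraicClosure ℚ))

instance : Algebra ℚ Qbar :=
  (AlgebraicClosure.instAlgebra ℚ : Algebra ℚ (AlgebraicClosure ℚ))

instance : IsAlgClosure ℚ Qbar :=
  ⟨AlgebraicClosure.isAlgClosed ℚ, AlgebraicClosure.isAlgebraic ℚ⟩

instance : Algebra.IsAlgebraic ℚ Qbar := IsAlgClosure.isAlgebraic

instance : IsGalois ℚ Qbar where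
  to_normal := IsAlgClosure.normal ℚ Qbar

/-- The absolute Galois group `Aut(ℚ̄/ℚ)`, with its Krull (profinite) topology. -/
abbrev GalQ : Type := Qbar ≃ₐ[ℚ] Qbar

/-- The set `Y` of places of `ℚ̄`. A place is an equivalence class of nontrivial absolute values;
it is represented here by its unique member whose restriction to `ℚ` is the usual archimedean
absolute value or, for some prime `p`, the usual `p`-adic one. -/
def Place : Type :=
  {y : AbsoluteValue Qbar ℝ //
    (∀ q : ℚ, y (algebraMap ℚ Qbar q) = ((|q| : ℚ) : ℝ)) ∨
    ∃ p : ℕ, p.Prime ∧ ∀ q : ℚ, y (algebraMap ℚ Qbar q) = ((padicNorm p q : ℚ) : ℝ)}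

namespace Place

/-- The normalized absolute value `‖x‖_y`. -/
def absVal (y : Place) : AbsoluteValue Qbar ℝ := y.1

@[ext] theorem ext {y z : Place} (h : ∀ x, y.absVal x = z.absVal x) : y = z :=
  Subtype.ext (AbsoluteValue.ext h)

/-- `Y(k, v)`: the places of `ℚ̄` lying over the same place `v` of `k` as `z` does. -/
def fiber (k : IntermediateField ℚ Qbar) (z : Place) : Set Place :=
  {y | ∀ x ∈ k, y.absVal x = z.absVal x}

/-- The topology on `Y`, generated by the sets `Y(k, v)`, where `k` is a number field and `v` is a
place of `k`. On each `Y(k, v)` this is the topology of the inverse limit of the finite sets of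
places of `l` over `v`, as `l` runs over the finite Galois extensions containing `k`. -/
instance : TopologicalSpace Place :=
  TopologicalSpace.generateFrom
    {S | ∃ (k : IntermediateField ℚ Qbar) (z : Place), FiniteDimensional ℚ k ∧ S = fiber k z}

instance : MeasurableSpace Place := borel Place

instance : BorelSpace Place := ⟨rfl⟩

/-- The Galois action on places: `‖x‖_{τ y} = ‖τ⁻¹ x‖_y`. -/
instance : MulAction GalQ Place where
  smul τ y := ⟨y.1.comp (f := ((τ⁻¹ : GalQ) : Qbar →+* Qbar)) (τ⁻¹ : GalQ).injective, by
    rcases y.2 with h | ⟨p, hp, h⟩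
    · exact Or.inl fun q => (congrArg y.1 ((τ⁻¹ : GalQ).commutes q)).trans (h q)
    · exact Or.inr ⟨p, hp, fun q => (congrArg y.1 ((τ⁻¹ : GalQ).commutes q)).trans (h q)⟩⟩
  one_smul y := ext fun _ => rfl
  mul_smul σ τ y := ext fun x => congrArg y.1 (by
    change (σ * τ)⁻¹ x = τ⁻¹ (σ⁻¹ x)
    rw [mul_inv_rev]; rfl)

theorem absVal_smul (τ : GalQ) (y : Place) (x : Qbar) :
    (τ • y).absVal x = y.absVal (τ⁻¹ x) := rfl

/-- The action `Aut(ℚ̄/ℚ) × Y → Y` is jointly continuous. -/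
instance : ContinuousSMul GalQ Place where
  continuous_smul := by
    refine continuous_generateFrom_iff.2 ?_
    rintro _ ⟨k, z, hk, rfl⟩
    rw [isOpen_iff_mem_nhds]
    rintro ⟨σ, y⟩ hy
    have hy' : ∀ x ∈ k, y.absVal (σ⁻¹ x) = z.absVal x := hy
    let k' : IntermediateField ℚ Qbar := k.map ((σ⁻¹ : GalQ) : Qbar →ₐ[ℚ] Qbar)
    have hk' : FiniteDimensional ℚ k' := IntermediateField.finiteDimensional_map _
    have h1 : IsOpen ((fun τ : GalQ => τ⁻¹ * σ) ⁻¹' (k'.fixingSubgroup : Set GalQ)) :=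
      k'.fixingSubgroup_isOpen.preimage (by fun_prop)
    have h2 : IsOpen (fiber k' y) := TopologicalSpace.isOpen_generateFrom_of_mem ⟨k', y, hk', rfl⟩
    refine Filter.mem_of_superset ((h1.prod h2).mem_nhds ⟨?_, fun _ _ => rfl⟩) ?_
    · simp
    · rintro ⟨τ, w⟩ ⟨hτ, hw⟩ x hx
      have hm : σ⁻¹ x ∈ k' := ⟨x, hx, rfl⟩
      have h3 : (τ⁻¹ * σ) (σ⁻¹ x) = σ⁻¹ x :=
        (IntermediateField.mem_fixingSubgroup_iff k' _).1 hτ _ hm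
      have h4 : (τ⁻¹ * σ) (σ⁻¹ x) = τ⁻¹ x := by
        rw [← AlgEquiv.mul_apply, mul_assoc, mul_inv_cancel, mul_one]
      change w.absVal (τ⁻¹ x) = z.absVal x
      rw [← h4, h3, hw _ hm, hy' x hx]

/-- A place of `ℚ̄` over the place `∞` (for `none`) or `p` (for `some p`) of `ℚ`, obtained from an
embedding of `ℚ̄` into `ℂ`, respectively into an algebraic closure of `ℚ_p`. -/
def base : Option Nat.Primes → Place
  | none => ⟨(NormedField.toAbsoluteValue ℂ).comp
      (f := ((IsAlgClosed.lift : Qbar →ₐ[ℚ] ℂ) : Qbar →+* ℂ)) (RingHom.injective _),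
      Or.inl fun q => by
        change ‖(IsAlgClosed.lift : Qbar →ₐ[ℚ] ℂ) (algebraMap ℚ Qbar q)‖ = _
        rw [AlgHom.commutes]; simp⟩
  | some p =>
      haveI : Fact (p : ℕ).Prime := ⟨p.2⟩
      ⟨(NormedField.toAbsoluteValue (PadicAlgCl p)).comp
      (f := ((IsAlgClosed.lift : Qbar →ₐ[ℚ] PadicAlgCl p) : Qbar →+* PadicAlgCl p))
        (RingHom.injective _),
      Or.inr ⟨p, p.2, fun q => by
        change ‖(IsAlgClosed.lift : Qbar →ₐ[ℚ] PadicAlgCl p) (algebraMap ℚ Qbar q)‖ = _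
        rw [AlgHom.commutes, IsScalarTower.algebraMap_apply ℚ ℚ_[p] (PadicAlgCl p)]
        refine (PadicAlgCl.norm_extends p _).trans ?_
        simp⟩⟩

end Place

instance : MeasurableSpace GalQ := borel GalQ

instance : BorelSpace GalQ := ⟨rfl⟩

instance : SecondCountableTopology GalQ := by
  have hc : Countable Qbar := Set.countable_univ_iff.1 <|
    (Algebraic.countable ℚ Qbar).mono fun x _ => Algebra.IsAlgebraic.isAlgebraic x
  let A : Qbar → Subgroup GalQ := fun x => (IntermediateField.adjoin ℚ {x}).fixingSubgroup
  have hA : ∀ x : Qbar, FiniteDimensional ℚ (IntermediateField.adjoin ℚ {x}) := fun x =>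
    IntermediateField.adjoin.finiteDimensional (Algebra.IsIntegral.isIntegral (R := ℚ) x)
  have hAo : ∀ x, IsOpen (A x : Set GalQ) := fun x => IntermediateField.fixingSubgroup_isOpen _
  have hq : ∀ x, Finite (GalQ ⧸ A x) := fun x => (A x).quotient_finite_of_isOpen (hAo x)
  let B : (Σ x : Qbar, GalQ ⧸ A x) → Set GalQ := fun i => {τ | (τ : GalQ ⧸ A i.1) = i.2}
  have hB : TopologicalSpace.IsTopologicalBasis (Set.range B) := by
    refine TopologicalSpace.isTopologicalBasis_of_isOpen_of_nhds ?_ ?_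
    · rintro _ ⟨⟨x, c⟩, rfl⟩
      have : DiscreteTopology (GalQ ⧸ A x) := QuotientGroup.discreteTopology (hAo x)
      exact (isOpen_discrete {c}).preimage QuotientGroup.continuous_mk
    · intro σ U hσ hU
      have h1 : (fun τ => σ * τ) ⁻¹' U ∈ nhds (1 : GalQ) :=
        (hU.preimage (continuous_const_mul σ)).mem_nhds (by simpa using hσ)
      obtain ⟨E, hE, hEU⟩ := (krullTopology_mem_nhds_one_iff ℚ Qbar _).1 h1
      obtain ⟨x, hx⟩ := @Field.exists_primitive_element ℚ E _ _ E.algebra' hE inferInstance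
      have hEx : IntermediateField.adjoin ℚ {(x : Qbar)} = E := by
        have := congrArg (IntermediateField.lift) hx
        simpa using this
      refine ⟨B ⟨x, (σ : GalQ ⧸ A x)⟩, ⟨_, rfl⟩, rfl, ?_⟩
      intro τ hτ
      have h2 : σ⁻¹ * τ ∈ A x := QuotientGroup.eq.1 (Eq.symm hτ)
      have h3 : σ⁻¹ * τ ∈ E.fixingSubgroup := by
        have h4 : A x = E.fixingSubgroup := congrArg IntermediateField.fixingSubgroup hEx
        rwa [← h4]
      simpa using hEU h3
  exact hB.secondCountableTopology (Set.countable_range B)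

instance (K : IntermediateField ℚ Qbar) : SecondCountableTopology K.fixingSubgroup :=
  Topology.IsInducing.subtypeVal.secondCountableTopology

instance (K : IntermediateField ℚ Qbar) : CompactSpace K.fixingSubgroup :=
  isCompact_iff_compactSpace.1 (InfiniteGalois.fixingSubgroup_isClosed K).isCompact

/-- The Haar measure of total mass `1` on the compact group `Aut(ℚ̄/K)`, a closed subgroup of
`Aut(ℚ̄/ℚ)`. -/
def haarK (K : IntermediateField ℚ Qbar) : Measure K.fixingSubgroup :=
  Measure.haarMeasure ⊤

instance (K : IntermediateField ℚ Qbar) : IsProbabilityMeasure (haarK K) :=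
  ⟨Measure.haarMeasure_self (K₀ := (⊤ : TopologicalSpace.PositiveCompacts K.fixingSubgroup))⟩

/-- The Haar measure of total mass `1` on the compact group `Aut(ℚ̄/ℚ)`. -/
def haarQ : Measure GalQ := Measure.haarMeasure ⊤

instance : IsProbabilityMeasure haarQ :=
  ⟨Measure.haarMeasure_self (K₀ := (⊤ : TopologicalSpace.PositiveCompacts GalQ))⟩

instance : haarQ.IsMulLeftInvariant := by unfold haarQ; infer_instance

/-- The measure `λ` on the Borel subsets of `Y`: on the set `Y(ℚ, u)` of places over the place `u`
of `ℚ`, it is the image of the normalized Haar measure of `Aut(ℚ̄/ℚ)` under the orbit map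
`τ ↦ τ y_u` of a place `y_u` over `u`. As `Aut(ℚ̄/ℚ)` acts transitively on `Y(ℚ, u)`, the choice of
`y_u` does not matter, and `λ` is the unique Galois-invariant Borel measure on `Y` with
`λ(Y(ℚ, u)) = 1` for every `u`; equivalently, the one with `λ(Y(k, v)) = [k_v : ℚ_v] / [k : ℚ]` for
every number field `k` that is Galois over `ℚ` and every place `v` of `k`. -/
def lam : Measure Place :=
  Measure.sum fun u : Option Nat.Primes => haarQ.map fun τ : GalQ => τ • Place.base u

instance : SFinite lam := by
  unfold lam
  infer_instance

theorem measurePreserving_smul (σ : GalQ) :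
    MeasurePreserving (fun y : Place => σ • y) lam lam := by
  have hm : Measurable (fun y : Place => σ • y) := (continuous_const_smul σ).measurable
  refine ⟨hm, ?_⟩
  unfold lam
  rw [Measure.map_sum hm.aemeasurable]
  congr 1
  funext u
  have h1 : Measurable fun τ : GalQ => τ • Place.base u := by
    exact (continuous_id.smul continuous_const).measurable
  rw [Measure.map_map hm h1]
  have : (fun y : Place => σ • y) ∘ (fun τ : GalQ => τ • Place.base u) =
    (fun τ : GalQ => τ • Place.base u) ∘ fun τ => σ * τ := by
    funext τ; simp [mul_smul]
  rw [this, ← Measure.map_map h1 (measurable_const_mul σ), map_mul_left_eq_self]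


/-- The real Banach space `L¹(Y, 𝓑, λ)`. -/
abbrev L1Y : Type := Lp ℝ 1 lam

/-- The closed subspace `𝓧` of `L¹(Y, 𝓑, λ)` of functions with integral `0`. -/
def X : Submodule ℝ L1Y where
  carrier := {F | ∫ y, F y ∂lam = 0}
  zero_mem' := by
    change ∫ y, (0 : L1Y) y ∂lam = 0
    rw [integral_congr_ae (Lp.coeFn_zero ℝ 1 lam)]
    simp
  add_mem' := by
    intro F H (hF : ∫ y, F y ∂lam = 0) (hH : ∫ y, H y ∂lam = 0)
    change ∫ y, (F + H : L1Y) y ∂lam = 0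
    rw [integral_congr_ae (Lp.coeFn_add F H)]
    simp [integral_add (L1.integrable_coeFn F) (L1.integrable_coeFn H), hF, hH]
  smul_mem' := by
    intro c F (hF : ∫ y, F y ∂lam = 0)
    change ∫ y, (c • F : L1Y) y ∂lam = 0
    rw [integral_congr_ae (Lp.coeFn_smul c F)]
    simp [integral_const_mul, hF]

theorem mem_X {F : L1Y} : F ∈ X ↔ ∫ y, F y ∂lam = 0 := Iff.rfl

/-- The function `y ↦ ∫ F(τ⁻¹ y) dν_K(τ)`, the integral being over `Aut(ℚ̄/K)`. -/
def avg (K : IntermediateField ℚ Qbar) (F : Place → ℝ) (y : Place) : ℝ :=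
  ∫ τ : K.fixingSubgroup, F ((τ : GalQ)⁻¹ • y) ∂haarK K

theorem measurePreserving_skew (K : IntermediateField ℚ Qbar) :
    MeasurePreserving (fun z : K.fixingSubgroup × Place => (z.1, (z.1 : GalQ)⁻¹ • z.2))
      ((haarK K).prod lam) ((haarK K).prod lam) := by
  refine (MeasurePreserving.id (haarK K)).skew_product
    (g := fun (τ : K.fixingSubgroup) (y : Place) => (τ : GalQ)⁻¹ • y) ?_ ?_
  · have : Continuous fun z : K.fixingSubgroup × Place => (z.1 : GalQ)⁻¹ • z.2 := by fun_prop
    exact this.measurable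
  · exact Filter.Eventually.of_forall fun τ => (measurePreserving_smul _).map_eq

theorem measurePreserving_act (K : IntermediateField ℚ Qbar) :
    MeasurePreserving (fun z : K.fixingSubgroup × Place => (z.1 : GalQ)⁻¹ • z.2)
      ((haarK K).prod lam) lam :=
  measurePreserving_snd.comp (measurePreserving_skew K)

theorem integrable_act (K : IntermediateField ℚ Qbar) {F : Place → ℝ} (hF : Integrable F lam) :
    Integrable (fun z : K.fixingSubgroup × Place => F ((z.1 : GalQ)⁻¹ • z.2))
      ((haarK K).prod lam) :=
  (measurePreserving_act K).integrable_comp_of_integrable hF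

/-- For `F` in `L¹` and almost every `y`, the function `τ ↦ F(τ⁻¹ y)` is integrable. -/
theorem ae_integrable_act (K : IntermediateField ℚ Qbar) {F : Place → ℝ}
    (hF : Integrable F lam) :
    ∀ᵐ y ∂lam, Integrable (fun τ : K.fixingSubgroup => F ((τ : GalQ)⁻¹ • y)) (haarK K) :=
  (integrable_act K hF).prod_left_ae

theorem integrable_avg (K : IntermediateField ℚ Qbar) {F : Place → ℝ} (hF : Integrable F lam) :
    Integrable (avg K F) lam :=
  (integrable_act K hF).integral_prod_right

theorem avg_congr (K : IntermediateField ℚ Qbar) {F H : Place → ℝ} (h : F =ᵐ[lam] H) :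
    avg K F =ᵐ[lam] avg K H := by
  have h1 := (measurePreserving_act K).quasiMeasurePreserving.ae h
  have h2 := Measure.ae_ae_of_ae_prod
    ((Measure.measurePreserving_swap (μ := lam) (ν := haarK K)).quasiMeasurePreserving.ae h1)
  filter_upwards [h2] with y hy
  exact integral_congr_ae hy

theorem integral_avg (K : IntermediateField ℚ Qbar) {F : Place → ℝ} (hF : Integrable F lam) :
    ∫ y, avg K F y ∂lam = ∫ y, F y ∂lam := by
  have h := integral_prod_symm _ (integrable_act K hF)
  refine h.symm.trans ?_
  rw [integral_prod _ (integrable_act K hF)]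
  have : ∀ τ : K.fixingSubgroup, ∫ y, F ((τ : GalQ)⁻¹ • y) ∂lam = ∫ y, F y ∂lam := fun τ =>
    (measurePreserving_smul _).integral_comp
      (Homeomorph.smul ((τ : GalQ)⁻¹)).measurableEmbedding F
  simp [this]

theorem integral_abs_avg_le (K : IntermediateField ℚ Qbar) {F : Place → ℝ}
    (hF : Integrable F lam) : ∫ y, ‖avg K F y‖ ∂lam ≤ ∫ y, ‖F y‖ ∂lam := by
  rw [← integral_avg K hF.norm]
  exact integral_mono (integrable_avg K hF).norm (integrable_avg K hF.norm)
    fun y => norm_integral_le_integral_norm _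

/-- The averaging operator `U_K` on `𝓧`: for almost every `y`,
`U_K(F)(y) = ∫ F(τ⁻¹ y) dν_K(τ)`. -/
def U (K : IntermediateField ℚ Qbar) : X →L[ℝ] X :=
  LinearMap.mkContinuous
    { toFun := fun F => ⟨(integrable_avg K (L1.integrable_coeFn (F : L1Y))).toL1 _, by
        rw [mem_X, integral_congr_ae (Integrable.coeFn_toL1 (integrable_avg K (L1.integrable_coeFn _))),
          integral_avg K (L1.integrable_coeFn _)]
        exact F.2⟩
      map_add' := by
        intro F H
        refine Subtype.ext ?_
        change Integrable.toL1 _ (integrable_avg K (L1.integrable_coeFn _)) = Integrable.toL1 _ (integrable_avg K (L1.integrable_coeFn _)) + Integrable.toL1 _ (integrable_avg K (L1.integrable_coeFn _))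
        rw [← Integrable.toL1_add, Integrable.toL1_eq_toL1_iff]
        refine (avg_congr K (Lp.coeFn_add (F : L1Y) (H : L1Y))).trans ?_
        filter_upwards [ae_integrable_act K (L1.integrable_coeFn (F : L1Y)),
          ae_integrable_act K (L1.integrable_coeFn (H : L1Y))] with y h1 h2
        exact integral_add h1 h2
      map_smul' := by
        intro c F
        refine Subtype.ext ?_
        change Integrable.toL1 _ (integrable_avg K (L1.integrable_coeFn _)) = c • Integrable.toL1 _ (integrable_avg K (L1.integrable_coeFn _))
        rw [← Integrable.toL1_smul, Integrable.toL1_eq_toL1_iff]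
        refine (avg_congr K (Lp.coeFn_smul c (F : L1Y))).trans ?_
        exact Filter.Eventually.of_forall fun y => integral_const_mul c _ }
    1 (by
      intro F
      change ‖Integrable.toL1 _ (integrable_avg K (L1.integrable_coeFn _))‖ ≤ 1 * ‖(F : L1Y)‖
      rw [one_mul, L1.norm_eq_integral_norm, L1.norm_eq_integral_norm]
      refine (integral_congr_ae ((Integrable.coeFn_toL1
        (integrable_avg K (L1.integrable_coeFn (F : L1Y)))).fun_comp norm)).trans_le ?_
      exact integral_abs_avg_le K (L1.integrable_coeFn _))

theorem U_apply_ae (K : IntermediateField ℚ Qbar) (F : X) :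
    ((U K F : L1Y) : Place → ℝ) =ᵐ[lam] avg K (F : L1Y) :=
  Integrable.coeFn_toL1 (integrable_avg K (L1.integrable_coeFn _))

end WeilHeight

end

open MeasureTheory

/-! Write G_K for Aut(ℚ̄/K). If K is Galois over K ∩ L, then G_K is normal in the fixing group of K
∩ L, and that group contains G_L; so every τ in G_L normalizes G_K. Conjugation by τ is then a
continuous automorphism of the compact group G_K, and it preserves the Haar measure because the
total mass is finite and unchanged (`integral_conj`). At almost every y, U_K U_L F is the double
integral of F(τ⁻¹σ⁻¹y) over σ in G_K and τ in G_L. Fubini puts the integral over σ inside, and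
replacing σ by τστ⁻¹ turns the integrand into F(σ⁻¹τ⁻¹y), whose double integral is U_L U_K F
(`avg_comm`). The case of L Galois over K ∩ L is the same with the roles exchanged. -/

namespace WeilHeight

/-- If `K / M` is normal, then automorphisms fixing `M` map `K` into itself. -/
theorem apply_mem_of_normal {M K : IntermediateField ℚ Qbar} (hMK : M ≤ K)
    (hn : Normal ↥M ↥(IntermediateField.extendScalars hMK)) {τ : GalQ}
    (hτ : τ ∈ M.fixingSubgroup) {x : Qbar} (hx : x ∈ K) : τ x ∈ K := by
  -- Viewed as an M-automorphism of ℚ̄, τ restricts to the normal extension K/M, and τ x is the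
  -- value of that restriction at x.
  have h := (AlgEquiv.restrictNormal_commutes (M.fixingSubgroupEquiv ⟨τ, hτ⟩)
    (IntermediateField.extendScalars hMK) (⟨x, hx⟩ : IntermediateField.extendScalars hMK))
  have h2 := (AlgEquiv.restrictNormal (M.fixingSubgroupEquiv ⟨τ, hτ⟩)
    (IntermediateField.extendScalars hMK) (⟨x, hx⟩ : IntermediateField.extendScalars hMK)).2
  change τ x ∈ IntermediateField.extendScalars hMK
  convert h2 using 1
  exact h.symm

/-- If `K / M` is normal, then `Aut(ℚ̄/M)` normalizes `Aut(ℚ̄/K)`. -/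
theorem conj_mem_fixingSubgroup {M K : IntermediateField ℚ Qbar} (hMK : M ≤ K)
    (hn : Normal ↥M ↥(IntermediateField.extendScalars hMK)) {τ σ : GalQ}
    (hτ : τ ∈ M.fixingSubgroup) (hσ : σ ∈ K.fixingSubgroup) :
    τ * σ * τ⁻¹ ∈ K.fixingSubgroup := by
  rw [IntermediateField.mem_fixingSubgroup_iff] at hσ ⊢
  intro x hx
  -- By normality τ⁻¹ x lies in K, so σ fixes it.
  have h := hσ _ (apply_mem_of_normal hMK hn (inv_mem hτ) hx)
  change τ (σ (τ⁻¹ x)) = x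
  rw [h]
  exact τ.apply_symm_apply x

instance (K : IntermediateField ℚ Qbar) : (haarK K).IsHaarMeasure := by
  unfold haarK; infer_instance

/-- An automorphism normalizing `Aut(ℚ̄/K)` acts on it by conjugation, preserving its Haar
measure. -/
theorem integral_conj (K : IntermediateField ℚ Qbar) {τ : GalQ}
    (h : ∀ σ ∈ K.fixingSubgroup, τ * σ * τ⁻¹ ∈ K.fixingSubgroup)
    (h' : ∀ σ ∈ K.fixingSubgroup, τ⁻¹ * σ * τ ∈ K.fixingSubgroup) (f : GalQ → ℝ) :
    ∫ σ : K.fixingSubgroup, f (τ * σ * τ⁻¹) ∂haarK K = ∫ σ : K.fixingSubgroup, f σ ∂haarK K := by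
  let e : K.fixingSubgroup ≃* K.fixingSubgroup :=
    { toFun := fun σ => ⟨τ * σ * τ⁻¹, h _ σ.2⟩
      invFun := fun σ => ⟨τ⁻¹ * σ * τ, h' _ σ.2⟩
      left_inv := fun σ => Subtype.ext (by simp [mul_assoc])
      right_inv := fun σ => Subtype.ext (by simp [mul_assoc])
      map_mul' := fun σ ρ => Subtype.ext (by simp [mul_assoc]) }
  have he : Continuous e := by
    refine Continuous.subtype_mk ?_ _
    fun_prop
  have he' : Continuous e.symm := by
    refine Continuous.subtype_mk ?_ _
    fun_prop
  -- A continuous surjective homomorphism of compact groups carries Haar measure to Haar measure;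
  -- the final `simp` checks that both total masses are 1, which fixes the scale.
  have hp : MeasurePreserving e (haarK K) (haarK K) :=
    MonoidHom.measurePreserving (f := e.toMonoidHom) he e.surjective (by simp)
  -- Since `e` is a homeomorphism, hence a measurable embedding, no measurability of `f` is needed.
  exact hp.integral_comp (Homeomorph.mk e.toEquiv he he').measurableEmbedding
    (fun σ : K.fixingSubgroup => f σ)

/-- For `F` in `L¹` and almost every `y`, the function `(σ, τ) ↦ F(τ⁻¹ σ⁻¹ y)` is integrable. -/
theorem ae_integrable_act_act (K L : IntermediateField ℚ Qbar) {F : Place → ℝ}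
    (hF : Integrable F lam) :
    ∀ᵐ y ∂lam, Integrable (fun z : K.fixingSubgroup × L.fixingSubgroup =>
      F ((z.2 : GalQ)⁻¹ • (z.1 : GalQ)⁻¹ • y)) ((haarK K).prod (haarK L)) := by
  have hc : Continuous fun w : (K.fixingSubgroup × L.fixingSubgroup) × Place =>
      (w.1.2 : GalQ)⁻¹ • (w.1.1 : GalQ)⁻¹ • w.2 := by fun_prop
  -- A shear over the group variables: for each fixed (σ, τ) the map on places preserves `lam`.
  -- Projecting to the second factor keeps the measure `lam`, as the groups have mass 1, so F pulls
  -- back to an integrable function, almost all of whose slices at y are integrable.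
  have h1 : MeasurePreserving (fun w : (K.fixingSubgroup × L.fixingSubgroup) × Place =>
      (w.1, (w.1.2 : GalQ)⁻¹ • (w.1.1 : GalQ)⁻¹ • w.2))
      (((haarK K).prod (haarK L)).prod lam) (((haarK K).prod (haarK L)).prod lam) :=
    (MeasurePreserving.id ((haarK K).prod (haarK L))).skew_product
      (g := fun (z : K.fixingSubgroup × L.fixingSubgroup) (y : Place) =>
        (z.2 : GalQ)⁻¹ • (z.1 : GalQ)⁻¹ • y) hc.measurable
      (Filter.Eventually.of_forall fun z =>
        ((measurePreserving_smul _).comp (measurePreserving_smul _)).map_eq)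
  exact ((measurePreserving_snd.comp h1).integrable_comp_of_integrable hF).prod_left_ae

/-- If `Aut(ℚ̄/L)` normalizes `Aut(ℚ̄/K)`, then averaging over the one commutes with averaging over
the other. -/
theorem avg_comm (K L : IntermediateField ℚ Qbar)
    (h : ∀ τ ∈ L.fixingSubgroup, ∀ σ ∈ K.fixingSubgroup, τ * σ * τ⁻¹ ∈ K.fixingSubgroup)
    {F : Place → ℝ} (hF : Integrable F lam) :
    avg K (avg L F) =ᵐ[lam] avg L (avg K F) := by
  filter_upwards [ae_integrable_act_act K L hF] with y hy
  -- After Fubini it remains to compare, for each fixed τ, the inner integrals over σ of F(τ⁻¹σ⁻¹y)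
  -- and F(σ⁻¹τ⁻¹y).
  refine (integral_integral_swap hy).trans (integral_congr_ae (Filter.Eventually.of_forall ?_))
  intro τ
  -- For f(σ) = F(τ⁻¹σ⁻¹y), the factors τ⁻¹τ cancel in f(τστ⁻¹), leaving F(σ⁻¹τ⁻¹y).
  refine (integral_conj K (h τ τ.2) (fun σ hσ => ?_)
    fun σ => F ((τ : GalQ)⁻¹ • σ⁻¹ • y)).symm.trans ?_
  · simpa using h _ (inv_mem τ.2) σ hσ
  · simp [avg, smul_smul, mul_assoc]

/-- The inner function is known only up to a null set; `avg_congr` makes this harmless for the outer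
average. -/
theorem U_comp_ae (K L : IntermediateField ℚ Qbar) (F : X) :
    ((U K (U L F) : L1Y) : Place → ℝ) =ᵐ[lam] avg K (avg L (F : L1Y)) :=
  (U_apply_ae K (U L F)).trans (avg_congr K (U_apply_ae L F))

/-- If `Aut(ℚ̄/L)` normalizes `Aut(ℚ̄/K)`, then `U_K` and `U_L` commute. -/
theorem U_comm (K L : IntermediateField ℚ Qbar)
    (h : ∀ τ ∈ L.fixingSubgroup, ∀ σ ∈ K.fixingSubgroup, τ * σ * τ⁻¹ ∈ K.fixingSubgroup) :
    (U K).comp (U L) = (U L).comp (U K) := by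
  ext1 F
  exact Subtype.ext (Lp.ext ((U_comp_ae K L F).trans
    ((avg_comm K L h (L1.integrable_coeFn (F : L1Y))).trans (U_comp_ae L K F).symm)))

end WeilHeight

theorem theorem7p2 (K L : IntermediateField ℚ WeilHeight.Qbar)
    (h : IsGalois ↥(K ⊓ L) ↥(IntermediateField.extendScalars (inf_le_left : K ⊓ L ≤ K)) ∨
      IsGalois ↥(K ⊓ L) ↥(IntermediateField.extendScalars (inf_le_right : K ⊓ L ≤ L))) :
    (WeilHeight.U K).comp (WeilHeight.U L) = (WeilHeight.U L).comp (WeilHeight.U K) := by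
  rcases h with h | h
  -- Fixing L implies fixing K ∩ L, so normality of K over K ∩ L applies to every τ in Aut(ℚ̄/L).
  · exact WeilHeight.U_comm K L fun τ hτ σ hσ => WeilHeight.conj_mem_fixingSubgroup inf_le_left
      h.to_normal (IntermediateField.fixingSubgroup_antitone inf_le_right hτ) hσ
  · exact (WeilHeight.U_comm L K fun τ hτ σ hσ => WeilHeight.conj_mem_fixingSubgroup inf_le_right
      h.to_normal (IntermediateField.fixingSubgroup_antitone inf_le_left hτ) hσ).symm
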